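/- Let $\varphi:\mathcal X\times\mathcal X\to\mathbb R$ be a positive (semi-definite) kernel, $n\ge 1$, and $x_1,\dots,x_n\in\mathcal X$ with $K_{ii}>0$ for all $i$, where $K_{ij}=\varphi(x_i,x_j)$. Let $G\in\mathbb R^{n\times n}$, $G_{ij}=\frac1n\frac{K_{ij}}{\sqrt{K_{ii}K_{jj}}}$, be the normalized kernel matrix, with eigenvalues $\lambda_1,\dots,\lambda_n\ge 0$, largest eigenvalue $\lambda_{\max}$, smallest eigenvalue $\lambda_{\min}$, and $\kappa=\lambda_{\max}/\lambda_{\min}$ if $\lambda_{\min}>0$. For real $\alpha>0$, $\alpha\ne1$ (in particular for every fractional $\alpha>0$), let $$\mathbf S_\alpha(G)=\frac1{1-\alpha}\log_2\Big(\sum_{i=1}^n\lambda_i^\alpha\Big)=\frac1{1-\alpha}\log_2\operatorname{tr}(G^\alpha).$$ Let $0<\epsilon<\frac13$, $0<\delta<1$, $s=\lceil 8\ln(2/\delta)/\epsilon^2\rceil$ and $$m=\left\lceil\alpha+\begin{cases}\sqrt{\kappa}\left(\dfrac{\Gamma(\alpha+\frac12)\Gamma(\alpha)}{\epsilon\,\pi^{3/2}}\right)^{1/(2\alpha)}&\text{if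 }\lambda_{\min}>0,\\[2ex]\left(\dfrac{n\,\Gamma(\alpha+\frac12)\Gamma(\alpha)}{\epsilon\,\pi^{3/2}}\right)^{1/(2\alpha)}&\text{if }\lambda_{\min}=0.\end{cases}\right\rceil$$ For $k\ge0$ put $$c_k=\frac{2\lambda_{\max}^\alpha\,\Gamma(\alpha+\frac12)\,(\alpha)_k}{\sqrt\pi\,\Gamma(\alpha+1)\,(\alpha+k)_k},\qquad (a)_k=a(a-1)\cdots(a-k+1),$$ the Chebyshev coefficients of $x^\alpha$ on $[0,\lambda_{\max}]$. Let $\mathbf g_1,\dots,\mathbf g_s$ be independent standard Gaussian random vectors in $\mathbb R^n$. For each $i$ run Clenshaw's recurrence: $\mathbf y_{m+2}=\mathbf y_{m+1}=\mathbf 0$ and $$\mathbf y_k=c_k\mathbf g_i+\tfrac{4}{\lambda_{\max}}G\mathbf y_{k+1}-2\mathbf y_{k+1}-\mathbf y_{k+2},\qquad k=m,m-1,\dots,0,$$ and set $F_i(G)=\frac12\mathbf g_i^\top(\mathbf y_0-\mathbf y_2)$; this equals $\mathbf g_i^\top f_m(G)\mathbf g_i$, where $f_m(x)=\frac{c_0}2+\sum_{k=1}^m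 c_kT_k\big(\tfrac{2x}{\lambda_{\max}}-1\big)$ and $T_k$ is the $k$-th Chebyshev polynomial of the first kind. The algorithm returns $$\tilde{\mathbf S}_\alpha(G)=\frac1{1-\alpha}\log_2\Big(\frac1s\sum_{i=1}^sF_i(G)\Big).$$ Then, with probability at least $1-\delta$, one has $\frac1s\sum_{i=1}^sF_i(G)>0$ (so that the output is well defined) and $$\big|\mathbf S_\alpha(G)-\tilde{\mathbf S}_\alpha(G)\big|\le\left|\frac1{1-\alpha}\log_2(1-3\epsilon)\right|.$$ -/

import Mathlib

open scoped Matrix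

noncomputable section

namespace RenyiChebyshev

/-- A real-valued positive (semi-definite) kernel: all its Gram matrices are symmetric PSD. -/
def IsPositiveKernel {X : Type*} (φ : X → X → ℝ) : Prop :=
  ∀ (N : ℕ) (z : Fin N → X), (Matrix.of fun i j => φ (z i) (z j)).PosSemidef

/-- The normalized kernel matrix `G i j = (1 / n) * K i j / √(K i i * K j j)`, where
`K i j = φ (x i) (x j)`. -/
def normalizedKernelMatrix {X : Type*} {n : ℕ} (φ : X → X → ℝ) (x : Fin n → X) :
    Matrix (Fin n) (Fin n) ℝ :=
  Matrix.of fun i j =>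
    1 / (n : ℝ) * (φ (x i) (x j) / √(φ (x i) (x i) * φ (x j) (x j)))

theorem IsPositiveKernel.isHermitian {X : Type*} {n : ℕ} {φ : X → X → ℝ}
    (hφ : IsPositiveKernel φ) (x : Fin n → X) : (normalizedKernelMatrix φ x).IsHermitian := by
  ext i j
  have h : φ (x j) (x i) = φ (x i) (x j) := by
    simpa using (hφ n x).isHermitian.apply i j
  simp [normalizedKernelMatrix, h, mul_comm (φ (x j) (x j))]

/-- The matrix-based Rényi entropy
`S_α(G) = 1 / (1 - α) * log₂ (tr (G ^ α)) = 1 / (1 - α) * log₂ (∑ i, λ_i(G) ^ α)`. -/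
def entropy {n : ℕ} {G : Matrix (Fin n) (Fin n) ℝ} (hG : G.IsHermitian) (α : ℝ) : ℝ :=
  1 / (1 - α) * Real.logb 2 (∑ i, hG.eigenvalues i ^ α)

/-- The largest eigenvalue. -/
def lambdaMax {n : ℕ} {G : Matrix (Fin n) (Fin n) ℝ} (hG : G.IsHermitian) : ℝ :=
  ⨆ i, hG.eigenvalues i

/-- The smallest eigenvalue. -/
def lambdaMin {n : ℕ} {G : Matrix (Fin n) (Fin n) ℝ} (hG : G.IsHermitian) : ℝ :=
  ⨅ i, hG.eigenvalues i

/-- The condition number `κ = λ_max / λ_min`. -/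
def condNumber {n : ℕ} {G : Matrix (Fin n) (Fin n) ℝ} (hG : G.IsHermitian) : ℝ :=
  lambdaMax hG / lambdaMin hG

/-- The falling factorial `(a)_k = a (a - 1) ⋯ (a - k + 1)`. -/
def fallingFactorial (a : ℝ) (k : ℕ) : ℝ := (descPochhammer ℝ k).eval a

/-- The Chebyshev coefficients of `x ^ α` on `[0, lam]`. -/
def chebCoeff (α lam : ℝ) (k : ℕ) : ℝ :=
  2 * lam ^ α * Real.Gamma (α + 1 / 2) * fallingFactorial α k /
    (√Real.pi * Real.Gamma (α + 1) * fallingFactorial (α + k) k)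

/-- The vectors of Clenshaw's recurrence for coefficients `c 0, …, c m`: `y (m+2) = y (m+1) = 0`
and `y k = c k g + 4 G y (k+1) / lam - 2 y (k+1) - y (k+2)` for `k = m, m-1, …, 0`. -/
def clenshaw {n : ℕ} (c : ℕ → ℝ) (lam : ℝ) (G : Matrix (Fin n) (Fin n) ℝ) (g : Fin n → ℝ)
    (m k : ℕ) : Fin n → ℝ :=
  if m < k then 0
  else c k • g + (4 / lam) • (G *ᵥ clenshaw c lam G g m (k + 1))
    - (2 : ℝ) • clenshaw c lam G g m (k + 1) - clenshaw c lam G g m (k + 2)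
termination_by m + 1 - k

/-- The quadratic form `F(G) = gᵀ f_m(G) g`, computed from Clenshaw's vectors as
`gᵀ (y 0 - y 2) / 2`, where `f_m = c 0 / 2 + ∑ k ∈ [1, m], c k T_k`; see `clenshawForm_eq`. -/
def clenshawForm {n : ℕ} (c : ℕ → ℝ) (lam : ℝ) (G : Matrix (Fin n) (Fin n) ℝ) (m : ℕ)
    (g : Fin n → ℝ) : ℝ :=
  g ⬝ᵥ (clenshaw c lam G g m 0 - clenshaw c lam G g m 2) / 2

/-- `f_m(G) = c 0 / 2 + ∑ k ∈ [1, m], c k T_k (2 G / lam - 1)`. -/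
def chebSum {n : ℕ} (c : ℕ → ℝ) (lam : ℝ) (G : Matrix (Fin n) (Fin n) ℝ) (m : ℕ) :
    Matrix (Fin n) (Fin n) ℝ :=
  (c 0 / 2) • 1 + ∑ k ∈ Finset.Icc 1 m,
    c k • Polynomial.aeval ((2 / lam) • G - 1) (Polynomial.Chebyshev.T ℝ (k : ℤ))

/-- Clenshaw's recurrence evaluates the quadratic form of the truncated Chebyshev series. -/
theorem clenshawForm_eq {n : ℕ} (c : ℕ → ℝ) (lam : ℝ) (G : Matrix (Fin n) (Fin n) ℝ) (m : ℕ)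
    (g : Fin n → ℝ) : clenshawForm c lam G m g = g ⬝ᵥ (chebSum c lam G m *ᵥ g) := by
  set B : Matrix (Fin n) (Fin n) ℝ := (2 / lam) • G - 1 with hB
  set y := clenshaw c lam G g m with hy
  have hzero : ∀ k, m < k → y k = 0 := fun k hk => by rw [hy, clenshaw, if_pos hk]
  have hrec : ∀ k, k ≤ m → y k = c k • g + (2 : ℝ) • (B *ᵥ y (k + 1)) - y (k + 2) := by
    intro k hk
    rw [hy, clenshaw, if_neg (not_lt.mpr hk), ← hy, hB, Matrix.sub_mulVec, Matrix.smul_mulVec,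
      Matrix.one_mulVec, smul_sub, smul_smul]
    have : (2 : ℝ) * (2 / lam) = 4 / lam := by ring
    rw [this]
    abel
  have hT : ∀ k : ℕ, Polynomial.aeval B (Polynomial.Chebyshev.T ℝ ((k + 2 : ℕ) : ℤ)) =
      (2 : ℝ) • (Polynomial.aeval B (Polynomial.Chebyshev.T ℝ ((k + 1 : ℕ) : ℤ)) * B)
        - Polynomial.aeval B (Polynomial.Chebyshev.T ℝ (k : ℤ)) := by
    intro k
    push_cast
    rw [Polynomial.Chebyshev.T_add_two, mul_assoc, mul_comm Polynomial.X]
    simp [two_mul, two_smul]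
  have key : ∀ j k : ℕ, k + j = m →
      ∑ i ∈ Finset.Icc (k + 1) m,
        (c i • Polynomial.aeval B (Polynomial.Chebyshev.T ℝ (i : ℤ))) *ᵥ g =
      Polynomial.aeval B (Polynomial.Chebyshev.T ℝ ((k + 1 : ℕ) : ℤ)) *ᵥ y (k + 1)
        - Polynomial.aeval B (Polynomial.Chebyshev.T ℝ (k : ℤ)) *ᵥ y (k + 2) := by
    intro j
    induction j with
    | zero =>
      intro k hk
      rw [Finset.Icc_eq_empty (by omega), hzero (k + 1) (by omega), hzero (k + 2) (by omega)]
      simp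
    | succ j ih =>
      intro k hk
      rw [← Finset.add_sum_Ioc_eq_sum_Icc (by omega), ← Finset.Icc_add_one_left_eq_Ioc,
        ih (k + 1) (by omega), hrec (k + 1) (by omega), hT k]
      simp only [Matrix.sub_mulVec, Matrix.smul_mulVec, Matrix.mulVec_sub, Matrix.mulVec_add,
        Matrix.mulVec_smul, Matrix.mulVec_mulVec, add_assoc, Nat.reduceAdd]
      abel
  have h0 := key m 0 (by omega)
  rw [clenshawForm, ← hy, hrec 0 (by omega), chebSum, ← hB, Matrix.add_mulVec,
    Matrix.sum_mulVec]
  simp only [zero_add] at h0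
  rw [h0]
  simp only [Nat.cast_zero, Nat.cast_one, Polynomial.Chebyshev.T_one, Polynomial.Chebyshev.T_zero,
    Polynomial.aeval_X, map_one, Matrix.one_mulVec, Matrix.smul_mulVec, zero_add,
    dotProduct_sub, dotProduct_add, dotProduct_smul, smul_eq_mul]
  ring

/-- The randomized estimate `(1 / s) ∑ i, F_i(G)` of `tr (G ^ α)` from query vectors `g i`. -/
def traceEstimate {n : ℕ} {G : Matrix (Fin n) (Fin n) ℝ} (hG : G.IsHermitian) (α : ℝ)
    (s m : ℕ) (g : Fin s → EuclideanSpace ℝ (Fin n)) : ℝ :=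
  1 / (s : ℝ) * ∑ i, clenshawForm (chebCoeff α (lambdaMax hG)) (lambdaMax hG) G m (g i).ofLp

/-- The output of the algorithm, `1 / (1 - α) * log₂ ((1 / s) ∑ i, F_i(G))`. -/
def entropyEstimate {n : ℕ} {G : Matrix (Fin n) (Fin n) ℝ} (hG : G.IsHermitian) (α : ℝ)
    (s m : ℕ) (g : Fin s → EuclideanSpace ℝ (Fin n)) : ℝ :=
  1 / (1 - α) * Real.logb 2 (traceEstimate hG α s m g)

/-- The number of query vectors, `⌈8 ln(2 / δ) / ε ^ 2⌉`. -/
def numVectors (ε δ : ℝ) : ℕ := ⌈8 * Real.log (2 / δ) / ε ^ 2⌉₊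

/-- The degree of the Chebyshev series. -/
def chebDegree {n : ℕ} {G : Matrix (Fin n) (Fin n) ℝ} (hG : G.IsHermitian) (α ε : ℝ) : ℕ :=
  ⌈α + if 0 < lambdaMin hG then
      √(condNumber hG) * (Real.Gamma (α + 1 / 2) * Real.Gamma α /
        (ε * Real.pi ^ (3 / 2 : ℝ))) ^ (1 / (2 * α))
    else
      ((n : ℝ) * Real.Gamma (α + 1 / 2) * Real.Gamma α /
        (ε * Real.pi ^ (3 / 2 : ℝ))) ^ (1 / (2 * α))⌉₊

end RenyiChebyshev

end

open scoped Matrix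

noncomputable section

namespace RenyiChebyshev

/-! Write T = tr(G^α). Three errors add up to at most 3εT, and the logarithm turns this into the
stated bound.

Approximation: with x = lam cos²u, the Chebyshev expansion of x^α is the Fourier series of |cos
u|^(2α), so f_m misses x^α by at most the tail ∑_{k>m} |c_k|. The recurrence (α+k+1) c_{k+1} = (α-k)
c_k makes this tail telescope, and Gamma estimates give a bound of order (m-α)^(-2α)
(`tsum_abs_chebCoeff_le`). The degree is chosen so that n times the tail is at most εT
(`card_mul_tsum_abs_chebCoeff_le`). Hence the eigenvalues μ_i of f_m(G) sum to T up to εT, and ∑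
|μ_i| ≤ (1+ε)T.

Sampling: in an eigenbasis each F_i is ∑ μ_j z_j² with independent standard normal z_j. A Chernoff
bound in terms of the trace norm (`measure_abs_gaussianTrace_sub_ge_le`) keeps the average within
ε(1+ε)T of ∑ μ_j, except with probability at most δ. -/

/-! ### Falling factorials and the Gamma function -/

theorem fallingFactorial_zero (a : ℝ) : fallingFactorial a 0 = 1 := by
  simp [fallingFactorial]

theorem fallingFactorial_succ (a : ℝ) (k : ℕ) :
    fallingFactorial a (k + 1) = fallingFactorial a k * (a - k) := by
  simp [fallingFactorial, descPochhammer_succ_right]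

theorem fallingFactorial_add_one_succ (a : ℝ) (k : ℕ) :
    fallingFactorial (a + 1) (k + 1) = (a + 1) * fallingFactorial a k := by
  simp [fallingFactorial, descPochhammer_succ_left]

theorem fallingFactorial_add_natCast_succ (a : ℝ) (k : ℕ) :
    fallingFactorial (a + (k + 1 : ℕ)) (k + 1) = (a + k + 1) * fallingFactorial (a + k) k := by
  rw [← fallingFactorial_add_one_succ]; push_cast; ring_nf

theorem fallingFactorial_add_natCast_mul_Gamma {a : ℝ} (ha : 0 < a) (k : ℕ) :
    fallingFactorial (a + k) k * Real.Gamma (a + 1) = Real.Gamma (a + k + 1) := by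
  induction k with
  | zero => simp [fallingFactorial_zero]
  | succ k ih =>
    rw [fallingFactorial_add_natCast_succ, mul_assoc, ih, ← Real.Gamma_add_one (by positivity)]
    push_cast; ring_nf

theorem fallingFactorial_add_natCast_pos {a : ℝ} (ha : 0 < a) (k : ℕ) :
    0 < fallingFactorial (a + k) k := by
  have h := fallingFactorial_add_natCast_mul_Gamma ha k
  have h1 : 0 < Real.Gamma (a + 1) := Real.Gamma_pos_of_pos (by positivity)
  have h2 : 0 < Real.Gamma (a + k + 1) := Real.Gamma_pos_of_pos (by positivity)
  exact pos_of_mul_pos_left (h ▸ h2) h1.le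

theorem fallingFactorial_mul_Gamma {a : ℝ} (ha : ∀ j : ℕ, a ≠ j) (k : ℕ) :
    fallingFactorial a k * Real.Gamma (a + 1 - k) = Real.Gamma (a + 1) := by
  induction k with
  | zero => simp [fallingFactorial_zero]
  | succ k ih =>
    rw [← ih, fallingFactorial_succ, mul_assoc]
    have h : a - k ≠ 0 := sub_ne_zero.2 (ha k)
    rw [show a + 1 - k = (a - k) + 1 by ring, Real.Gamma_add_one h]
    push_cast; ring_nf

/-- Off the integers (a)_k = Γ(a+1)/Γ(a+1-k); the reflection formula trades the denominator for
Γ(k-a) sin(·)/π, and |sin| ≤ 1. For an integer a < k the product contains the factor 0. -/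
theorem abs_fallingFactorial_le {a : ℝ} (ha : 0 < a) {k : ℕ} (hk : a < k) :
    |fallingFactorial a k| ≤ Real.Gamma (a + 1) * Real.Gamma (k - a) / Real.pi := by
  have h1 : 0 < Real.Gamma (a + 1) := Real.Gamma_pos_of_pos (by positivity)
  have h2 : 0 < Real.Gamma (k - a) := Real.Gamma_pos_of_pos (by linarith)
  by_cases hj : ∃ j : ℕ, a = j
  · obtain ⟨j, rfl⟩ := hj
    rw [fallingFactorial, descPochhammer_eval_coe_nat_of_lt (by exact_mod_cast hk), abs_zero]
    positivity
  · push Not at hj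
    have hf := fallingFactorial_mul_Gamma hj k
    have hr := Real.Gamma_mul_Gamma_one_sub (a + 1 - k)
    rw [show (1 : ℝ) - (a + 1 - k) = k - a by ring] at hr
    have hne : Real.Gamma (a + 1 - k) ≠ 0 := by
      intro h0; rw [h0, mul_zero] at hf; linarith
    -- Division by zero gives 0, so a vanishing sine would contradict the nonzero product of Gammas.
    have hs : Real.sin (Real.pi * (a + 1 - k)) ≠ 0 := by
      intro h0; rw [h0, div_zero] at hr; exact (mul_ne_zero hne h2.ne') hr
    rw [eq_div_iff hs] at hr
    have : fallingFactorial a k * Real.pi =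
        Real.Gamma (a + 1) * Real.Gamma (k - a) * Real.sin (Real.pi * (a + 1 - k)) := by
      rw [← hf]; linear_combination (-fallingFactorial a k) * hr
    rw [le_div_iff₀ Real.pi_pos]
    nth_rw 1 [← abs_of_pos Real.pi_pos]
    rw [← abs_mul, this, abs_mul, abs_of_pos (mul_pos h1 h2)]
    exact mul_le_of_le_one_right (by positivity) (Real.abs_sin_le_one _)

/-- A Gautschi-type bound, from the logarithmic convexity of `Γ`. -/
theorem rpow_mul_Gamma_add_one_le {y b : ℝ} (hy : 0 < y) (hb : 0 < b) :
    y ^ b * Real.Gamma (y + 1) ≤ Real.Gamma (y + 1 + b) := by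
  have h1 : 0 < Real.Gamma y := Real.Gamma_pos_of_pos hy
  have h2 : 0 < Real.Gamma (y + 1) := Real.Gamma_pos_of_pos (by positivity)
  have h3 : 0 < Real.Gamma (y + 1 + b) := Real.Gamma_pos_of_pos (by positivity)
  -- The slope of log Γ over [y, y+1] is log y; convexity bounds it by the slope over [y+1, y+1+b].
  have := Real.convexOn_log_Gamma.slope_mono_adjacent (x := y) (y := y + 1) (z := y + 1 + b)
    (Set.mem_Ioi.2 hy) (Set.mem_Ioi.2 (by positivity)) (by linarith) (by linarith)
  simp only [Function.comp_apply] at this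
  rw [Real.Gamma_add_one hy.ne', Real.log_mul hy.ne' h1.ne', ← Real.log_mul hy.ne' h1.ne',
    ← Real.Gamma_add_one hy.ne'] at this
  nth_rw 1 [Real.Gamma_add_one hy.ne'] at this
  rw [Real.log_mul hy.ne' h1.ne', show y + 1 - y = 1 by ring, show y + 1 + b - (y + 1) = b by ring,
    add_sub_cancel_right, div_one, le_div_iff₀ hb] at this
  rw [← Real.log_le_log_iff (by positivity) h3, Real.log_mul (by positivity) h2.ne',
    Real.log_rpow hy]
  linarith

/-! ### Recurrence, size and tail of the Chebyshev coefficients -/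

theorem chebCoeff_succ {α : ℝ} (hα : 0 < α) (lam : ℝ) (k : ℕ) :
    (α + k + 1) * chebCoeff α lam (k + 1) = (α - k) * chebCoeff α lam k := by
  have h1 : Real.Gamma (α + 1) ≠ 0 := (Real.Gamma_pos_of_pos (by positivity)).ne'
  have h2 := (fallingFactorial_add_natCast_pos hα k).ne'
  have h3 : α + k + 1 ≠ 0 := by positivity
  have h4 : √Real.pi ≠ 0 := by positivity
  rw [chebCoeff, chebCoeff, fallingFactorial_add_natCast_succ, fallingFactorial_succ]
  field_simp

theorem chebCoeff_eq_rpow_mul (α lam : ℝ) (k : ℕ) :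
    chebCoeff α lam k = lam ^ α * chebCoeff α 1 k := by
  simp only [chebCoeff, Real.one_rpow]; ring

theorem abs_chebCoeff_le {α lam : ℝ} (hα : 0 < α) (hlam : 0 < lam) {k : ℕ} (hk : α < k) :
    |chebCoeff α lam k| ≤ 2 * α * (lam ^ α * (Real.Gamma (α + 1 / 2) * Real.Gamma α) /
      Real.pi ^ (3 / 2 : ℝ)) * (Real.Gamma (k - α) / Real.Gamma (α + k + 1)) := by
  have h1 : 0 < Real.Gamma (α + 1) := Real.Gamma_pos_of_pos (by positivity)
  have h2 : 0 < Real.Gamma (α + 1 / 2) := Real.Gamma_pos_of_pos (by positivity)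
  have h3 : 0 < Real.Gamma (α + k + 1) := Real.Gamma_pos_of_pos (by positivity)
  have h4 := fallingFactorial_add_natCast_pos hα k
  have hpi : Real.pi ^ (3 / 2 : ℝ) = √Real.pi * Real.pi := by
    rw [show (3 / 2 : ℝ) = 1 / 2 + 1 by norm_num, Real.rpow_add Real.pi_pos, Real.rpow_one,
      Real.sqrt_eq_rpow]
  rw [chebCoeff, abs_div, abs_mul, abs_of_pos (show 0 < 2 * lam ^ α * Real.Gamma (α + 1 / 2) by
    positivity), abs_of_pos (show 0 < √Real.pi * Real.Gamma (α + 1) * fallingFactorial (α + k) k by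
    positivity), mul_assoc (√Real.pi), mul_comm (Real.Gamma (α + 1)),
    fallingFactorial_add_natCast_mul_Gamma hα, hpi]
  refine (div_le_div_of_nonneg_right (mul_le_mul_of_nonneg_left (abs_fallingFactorial_le hα hk)
    (by positivity)) (by positivity)).trans_eq ?_
  rw [Real.Gamma_add_one hα.ne']
  field_simp

/-- Past α the recurrence reads (k+1+α)|c_{k+1}| = (k-α)|c_k|, which exhibits |c_k| as a difference
of consecutive terms. -/
theorem two_mul_abs_chebCoeff {α : ℝ} (hα : 0 < α) (lam : ℝ) {k : ℕ} (hk : α < k) :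
    2 * α * |chebCoeff α lam k| =
      (k + α) * |chebCoeff α lam k| - ((k + 1 : ℕ) + α) * |chebCoeff α lam (k + 1)| := by
  have h := congrArg abs (chebCoeff_succ hα lam k)
  rw [abs_mul, abs_mul, abs_of_pos (by positivity), abs_of_neg (show α - k < 0 by linarith)] at h
  push_cast
  linear_combination h

theorem sum_abs_chebCoeff_le {α : ℝ} (hα : 0 < α) (lam : ℝ) {m : ℕ} (hm : α < m) (N : ℕ) :
    ∑ i ∈ Finset.range N, |chebCoeff α lam (i + (m + 1))| ≤
      (m - α) * |chebCoeff α lam m| / (2 * α) := by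
  have h := congrArg abs (chebCoeff_succ hα lam m)
  rw [abs_mul, abs_mul, abs_of_pos (by positivity), abs_of_neg (show α - m < 0 by linarith)] at h
  -- The telescoped sum is exact; the bound only drops the last, nonpositive term.
  have key : 2 * α * ∑ i ∈ Finset.range N, |chebCoeff α lam (i + (m + 1))| =
      (m - α) * |chebCoeff α lam m| -
        ((N + (m + 1) : ℕ) + α) * |chebCoeff α lam (N + (m + 1))| := by
    induction N with
    | zero =>
      simp only [Finset.range_zero, Finset.sum_empty, zero_add]
      push_cast
      linear_combination h
    | succ N ih =>
      rw [Finset.sum_range_succ, mul_add, ih, two_mul_abs_chebCoeff hα lam (k := N + (m + 1))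
        (by push_cast; have : (0:ℝ) ≤ N := N.cast_nonneg
            linarith), show N + 1 + (m + 1) = N + (m + 1) + 1 by ring]
      ring
  rw [le_div_iff₀ (by positivity), mul_comm, key]
  have : 0 ≤ ((N + (m + 1) : ℕ) + α) * |chebCoeff α lam (N + (m + 1))| := by positivity
  linarith

theorem summable_abs_chebCoeff {α : ℝ} (hα : 0 < α) (lam : ℝ) :
    Summable fun k => |chebCoeff α lam k| := by
  obtain ⟨m, hm⟩ := exists_nat_gt α
  rw [← summable_nat_add_iff (m + 1)]
  exact summable_of_sum_range_le (fun _ => abs_nonneg _) (sum_abs_chebCoeff_le hα lam hm)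

/-- The factor m-α from telescoping turns Γ(m-α) into Γ(m-α+1), and log-convexity with y = m-α, b =
2α bounds the remaining Gamma quotient. -/
theorem tsum_abs_chebCoeff_le {α lam : ℝ} (hα : 0 < α) (hlam : 0 < lam) {m : ℕ} (hm : α < m) :
    ∑' i, |chebCoeff α lam (i + (m + 1))| ≤ lam ^ α *
      (Real.Gamma (α + 1 / 2) * Real.Gamma α / Real.pi ^ (3 / 2 : ℝ)) / (m - α) ^ (2 * α) := by
  have hy : 0 < m - α := by linarith
  have h2 : 0 < Real.Gamma (α + 1 / 2) := Real.Gamma_pos_of_pos (by positivity)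
  have h1 : 0 < Real.Gamma α := Real.Gamma_pos_of_pos (by positivity)
  have h3 : 0 < Real.Gamma (α + m + 1) := Real.Gamma_pos_of_pos (by positivity)
  refine (Real.tsum_le_of_sum_range_le (fun _ => abs_nonneg _)
    (sum_abs_chebCoeff_le hα lam hm)).trans ?_
  have hG := rpow_mul_Gamma_add_one_le hy (show 0 < 2 * α by positivity)
  rw [show (m : ℝ) - α + 1 + 2 * α = α + m + 1 by ring] at hG
  calc (m - α) * |chebCoeff α lam m| / (2 * α)
      ≤ (m - α) * (2 * α * (lam ^ α * (Real.Gamma (α + 1 / 2) * Real.Gamma α) /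
      Real.pi ^ (3 / 2 : ℝ)) * (Real.Gamma (m - α) / Real.Gamma (α + m + 1))) / (2 * α) := by
        gcongr; exact abs_chebCoeff_le hα hlam hm
    _ = lam ^ α * (Real.Gamma (α + 1 / 2) * Real.Gamma α / Real.pi ^ (3 / 2 : ℝ)) *
        (Real.Gamma (m - α + 1) / Real.Gamma (α + m + 1)) := by
        rw [Real.Gamma_add_one hy.ne']; field_simp
    _ ≤ lam ^ α * (Real.Gamma (α + 1 / 2) * Real.Gamma α / Real.pi ^ (3 / 2 : ℝ)) *
        (1 / (m - α) ^ (2 * α)) := by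
        refine mul_le_mul_of_nonneg_left ?_ (by positivity)
        rw [div_le_div_iff₀ h3 (by positivity)]
        linarith
    _ = _ := by ring

/-! ### Cosine moments of cos^(2α) -/

/-- The function cos^(2α+1)(u) sin((2k+1)u) vanishes at both endpoints, and its derivative combines
the two integrands. The result is the recurrence satisfied by `chebCoeff`. -/
theorem integral_rpow_cos_mul_cos_succ {α : ℝ} (hα : 0 < α) (k : ℕ) :
    (α + k + 1) * ∫ u in (0 : ℝ)..(Real.pi / 2),
        Real.cos u ^ (2 * α) * Real.cos (2 * (k + 1 : ℕ) * u) =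
      (α - k) * ∫ u in (0 : ℝ)..(Real.pi / 2), Real.cos u ^ (2 * α) * Real.cos (2 * k * u) := by
  have hc : Continuous fun u => Real.cos u ^ (2 * α) :=
    Real.continuous_cos.rpow_const fun _ => Or.inr (by positivity)
  have hcont : ∀ j : ℕ, Continuous fun u => Real.cos u ^ (2 * α) * Real.cos (2 * j * u) :=
    fun j => hc.mul (by fun_prop)
  have hderiv : ∀ u ∈ Set.uIcc (0 : ℝ) (Real.pi / 2),
      HasDerivAt (fun u => Real.cos u ^ (2 * α + 1) * Real.sin ((2 * k + 1) * u))
        ((k - α) * (Real.cos u ^ (2 * α) * Real.cos (2 * k * u)) +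
          (α + k + 1) * (Real.cos u ^ (2 * α) * Real.cos (2 * (k + 1 : ℕ) * u))) u := by
    intro u hu
    rw [Set.uIcc_of_le (by positivity)] at hu
    have h0 : 0 ≤ Real.cos u :=
      Real.cos_nonneg_of_neg_pi_div_two_le_of_le (by linarith [hu.1, Real.pi_pos]) hu.2
    have h1 := (Real.hasDerivAt_cos u).rpow_const (p := 2 * α + 1) (Or.inr (by linarith))
    have h2 := ((hasDerivAt_id u).const_mul (2 * (k : ℝ) + 1)).sin
    refine (h1.mul h2).congr_deriv ?_
    simp only [id]
    rw [add_sub_cancel_right, Real.rpow_add_one' h0 (by positivity), mul_one]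
    have e1 : Real.cos (2 * k * u) = Real.cos ((2 * k + 1) * u) * Real.cos u +
        Real.sin ((2 * k + 1) * u) * Real.sin u := by
      rw [← Real.cos_sub]; ring_nf
    have e2 : Real.cos (2 * (k + 1 : ℕ) * u) = Real.cos ((2 * k + 1) * u) * Real.cos u -
        Real.sin ((2 * k + 1) * u) * Real.sin u := by
      rw [← Real.cos_add]; push_cast; ring_nf
    rw [e1, e2]
    ring
  have hI := intervalIntegral.integral_eq_sub_of_hasDerivAt hderiv
    (((hcont k).const_mul _).add ((hcont (k + 1)).const_mul _) |>.intervalIntegrable _ _)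
  rw [intervalIntegral.integral_add ((hcont k).const_mul _ |>.intervalIntegrable _ _)
    ((hcont (k + 1)).const_mul _ |>.intervalIntegrable _ _),
    intervalIntegral.integral_const_mul, intervalIntegral.integral_const_mul,
    Real.cos_pi_div_two, mul_zero, Real.sin_zero, Real.zero_rpow (by positivity)] at hI
  linear_combination hI

theorem betaIntegral_ofReal_eq (a b : ℝ) :
    Complex.betaIntegral a b = ((∫ x in (0 : ℝ)..1, x ^ (a - 1) * (1 - x) ^ (b - 1) : ℝ) : ℂ) := by
  rw [Complex.betaIntegral, ← intervalIntegral.integral_ofReal]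
  refine intervalIntegral.integral_congr fun x hx => ?_
  rw [Set.uIcc_of_le zero_le_one] at hx
  rw [Complex.ofReal_mul, Complex.ofReal_cpow hx.1, Complex.ofReal_cpow (sub_nonneg.2 hx.2)]
  push_cast
  rfl

theorem integrableOn_rpow_mul_one_sub_rpow {a b : ℝ} (ha : 0 < a) (hb : 0 < b) :
    MeasureTheory.IntegrableOn (fun x : ℝ => x ^ (a - 1) * (1 - x) ^ (b - 1)) (Set.Icc 0 1) := by
  have h := Complex.betaIntegral_convergent (u := a) (v := b) (by simpa) (by simpa)
  rw [intervalIntegrable_iff_integrableOn_Icc_of_le zero_le_one] at h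
  refine (MeasureTheory.Integrable.re h).congr ?_
  filter_upwards [MeasureTheory.ae_restrict_mem measurableSet_Icc] with x hx
  have : ((x : ℂ) ^ ((a : ℂ) - 1) * (1 - (x : ℂ)) ^ ((b : ℂ) - 1)) =
      ((x ^ (a - 1) * (1 - x) ^ (b - 1) : ℝ) : ℂ) := by
    rw [Complex.ofReal_mul, Complex.ofReal_cpow hx.1, Complex.ofReal_cpow (sub_nonneg.2 hx.2)]
    push_cast
    rfl
  rw [this]
  simp

/-- The substitution x = sin²u in the Beta integral B(1/2, α+1/2). -/
theorem integral_rpow_cos {α : ℝ} (hα : 0 < α) :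
    ∫ u in (0 : ℝ)..(Real.pi / 2), Real.cos u ^ (2 * α) =
      √Real.pi * Real.Gamma (α + 1 / 2) / (2 * Real.Gamma (α + 1)) := by
  have hbeta : ∫ x in (0 : ℝ)..1, x ^ ((1 / 2 : ℝ) - 1) * (1 - x) ^ (α + 1 / 2 - 1) =
      √Real.pi * Real.Gamma (α + 1 / 2) / Real.Gamma (α + 1) := by
    have h := ProbabilityTheory.beta_eq_betaIntegralReal (1 / 2) (α + 1 / 2)
      (by positivity) (by positivity)
    rw [betaIntegral_ofReal_eq, Complex.ofReal_re, ProbabilityTheory.beta, Real.Gamma_one_half_eq,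
      show (1 / 2 : ℝ) + (α + 1 / 2) = α + 1 by ring] at h
    exact h.symm
  have hle : (0 : ℝ) ≤ Real.pi / 2 := by positivity
  have hpos : ∀ u ∈ Set.Ioo (0 : ℝ) (Real.pi / 2), 0 < Real.cos u ∧ 0 < Real.sin u := fun u hu =>
    ⟨Real.cos_pos_of_mem_Ioo ⟨by linarith [hu.1, Real.pi_pos], hu.2⟩,
      Real.sin_pos_of_pos_of_lt_pi hu.1 (by linarith [hu.2, Real.pi_pos])⟩
  -- The identity fails at u = 0, where x^(-1/2) is singular; the endpoints form a null set.
  have hpt : ∀ u ∈ Set.Ioo (0 : ℝ) (Real.pi / 2),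
      ((fun x : ℝ => x ^ ((1 / 2 : ℝ) - 1) * (1 - x) ^ (α + 1 / 2 - 1)) ∘
        fun u => Real.sin u ^ 2) u * (2 * Real.sin u * Real.cos u) =
      2 * Real.cos u ^ (2 * α) := by
    intro u hu
    obtain ⟨hc, hs⟩ := hpos u hu
    simp only [Function.comp_apply]
    rw [← Real.cos_sq', ← Real.rpow_natCast_mul hs.le, ← Real.rpow_natCast_mul hc.le,
      show ((2 : ℕ) : ℝ) * (1 / 2 - 1) = -1 by norm_num,
      show ((2 : ℕ) : ℝ) * (α + 1 / 2 - 1) = 2 * α - 1 by push_cast; ring,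
      Real.rpow_neg_one, Real.rpow_sub_one hc.ne']
    field_simp
  have hae : ∀ᵐ u ∂MeasureTheory.volume.restrict (Set.Icc (0 : ℝ) (Real.pi / 2)),
      u ∈ Set.Ioo (0 : ℝ) (Real.pi / 2) := by
    rw [← MeasureTheory.restrict_Ioo_eq_restrict_Icc]
    exact MeasureTheory.ae_restrict_mem measurableSet_Ioo
  have himg : (fun u => Real.sin u ^ 2) '' Set.uIcc 0 (Real.pi / 2) ⊆ Set.Icc 0 1 := by
    rintro _ ⟨u, -, rfl⟩
    exact ⟨sq_nonneg _, Real.sin_sq_le_one u⟩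
  have hcont : Continuous fun u => 2 * Real.cos u ^ (2 * α) :=
    (Real.continuous_cos.rpow_const fun _ => Or.inr (by positivity)).const_mul _
  have key := intervalIntegral.integral_comp_mul_deriv''' (a := 0) (b := Real.pi / 2)
    (f := fun u => Real.sin u ^ 2) (f' := fun u => 2 * Real.sin u * Real.cos u)
    (g := fun x : ℝ => x ^ ((1 / 2 : ℝ) - 1) * (1 - x) ^ (α + 1 / 2 - 1))
    (by fun_prop)
    (fun u _ => (((Real.hasDerivAt_sin u).pow 2).congr_deriv (by simp)).hasDerivWithinAt)
    (by
      rw [min_eq_left hle, max_eq_right hle]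
      rintro _ ⟨u, hu, rfl⟩
      obtain ⟨hc, hs⟩ := hpos u hu
      have h2 : 1 - Real.sin u ^ 2 ≠ 0 := by rw [← Real.cos_sq']; positivity
      refine ContinuousAt.continuousWithinAt ?_
      exact (Real.continuousAt_rpow_const _ _ (Or.inl (by positivity))).mul
        (ContinuousAt.rpow_const (by fun_prop) (Or.inl h2)))
    ((integrableOn_rpow_mul_one_sub_rpow (by positivity) (by positivity)).mono_set himg)
    (by
      rw [Set.uIcc_of_le hle]
      refine (hcont.integrableOn_Icc).congr ?_
      filter_upwards [hae] with u hu
      exact (hpt u hu).symm)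
  simp only [Real.sin_zero, Real.sin_pi_div_two, one_pow, ne_eq, OfNat.ofNat_ne_zero,
    not_false_eq_true, zero_pow] at key
  rw [hbeta, intervalIntegral.integral_of_le hle, MeasureTheory.integral_Ioc_eq_integral_Ioo,
    MeasureTheory.setIntegral_congr_fun measurableSet_Ioo hpt,
    ← MeasureTheory.integral_Ioc_eq_integral_Ioo, ← intervalIntegral.integral_of_le hle,
    intervalIntegral.integral_const_mul] at key
  rw [mul_comm 2 (Real.Gamma _), ← div_div, ← key]
  ring

theorem integral_rpow_cos_mul_cos {α : ℝ} (hα : 0 < α) (k : ℕ) :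
    ∫ u in (0 : ℝ)..(Real.pi / 2), Real.cos u ^ (2 * α) * Real.cos (2 * k * u) =
      Real.pi / 4 * chebCoeff α 1 k := by
  induction k with
  | zero =>
    simp only [Nat.cast_zero, mul_zero, zero_mul, Real.cos_zero, mul_one]
    rw [integral_rpow_cos hα, chebCoeff]
    simp only [fallingFactorial_zero, Real.one_rpow, mul_one]
    have h1 : Real.Gamma (α + 1) ≠ 0 := (Real.Gamma_pos_of_pos (by positivity)).ne'
    have h4 : √Real.pi ≠ 0 := by positivity
    field_simp
    rw [Real.sq_sqrt Real.pi_pos.le]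
    ring
  | succ k ih =>
    have h := integral_rpow_cos_mul_cos_succ hα k
    rw [ih] at h
    have h' := chebCoeff_succ hα 1 k
    have h3 : α + k + 1 ≠ 0 := by positivity
    apply mul_left_cancel₀ h3
    rw [h]
    linear_combination (-Real.pi / 4) * h'

/-! ### Fourier series of |cos u|^(2α) and the truncation error -/

instance fact_pi_pos : Fact (0 < Real.pi) := ⟨Real.pi_pos⟩

/-- Period π is the right one: on ℝ/πℤ the n-th character is e^(2inu), matching T_n(cos 2u) = cos
2nu. -/
theorem periodic_abs_cos_rpow (α : ℝ) :
    Function.Periodic (fun u : ℝ => ((|Real.cos u| ^ (2 * α) : ℝ) : ℂ)) Real.pi := fun u => by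
  simp [Real.cos_add_pi]

/-- The function `|cos u| ^ (2 α)` on the circle `ℝ / π ℤ`. -/
def absCosRpow {α : ℝ} (hα : 0 < α) : C(AddCircle Real.pi, ℂ) where
  toFun := (periodic_abs_cos_rpow α).lift
  continuous_toFun := by
    refine isQuotientMap_quotient_mk'.continuous_iff.2 ?_
    exact Complex.continuous_ofReal.comp
      (Real.continuous_cos.abs.rpow_const fun _ => Or.inr (by positivity))

theorem absCosRpow_coe {α : ℝ} (hα : 0 < α) (u : ℝ) :
    absCosRpow hα (u : AddCircle Real.pi) = ((|Real.cos u| ^ (2 * α) : ℝ) : ℂ) := rfl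

theorem fourier_pi_coe (n : ℤ) (u : ℝ) :
    fourier n (u : AddCircle Real.pi) = Complex.exp ((2 * n * u : ℝ) * Complex.I) := by
  rw [fourier_coe_apply]
  congr 1
  have : (Real.pi : ℂ) ≠ 0 := Complex.ofReal_ne_zero.2 Real.pi_ne_zero
  push_cast
  field_simp

theorem fourierCoeff_absCosRpow {α : ℝ} (hα : 0 < α) (n : ℤ) :
    fourierCoeff (absCosRpow hα) n = ((chebCoeff α 1 n.natAbs / 2 : ℝ) : ℂ) := by
  rw [fourierCoeff_eq_intervalIntegral _ n (-(Real.pi / 2)),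
    show -(Real.pi / 2) + Real.pi = Real.pi / 2 by ring]
  set h : ℝ → ℂ := fun x => fourier (-n) (x : AddCircle Real.pi) • absCosRpow hα x with hh
  have hcont : Continuous h :=
    ((fourier (-n)).continuous.comp (AddCircle.continuous_mk' _)).smul
      ((absCosRpow hα).continuous.comp (AddCircle.continuous_mk' _))
  -- Folding by x ↦ -x pairs conjugate exponentials into cosines and makes cos x nonnegative, so the
  -- absolute value disappears.
  have hsplit : ∫ x in (-(Real.pi / 2))..(Real.pi / 2), h x =
      ∫ x in (0 : ℝ)..(Real.pi / 2), (h (-x) + h x) := by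
    rw [← intervalIntegral.integral_add_adjacent_intervals (b := 0)
      (hcont.intervalIntegrable _ _) (hcont.intervalIntegrable _ _),
      intervalIntegral.integral_add ((show Continuous fun x => h (-x) from
        hcont.comp continuous_neg).intervalIntegrable _ _)
      (hcont.intervalIntegrable _ _), intervalIntegral.integral_comp_neg, neg_zero]
  have hval : ∫ x in (0 : ℝ)..(Real.pi / 2), (h (-x) + h x) =
      ∫ x in (0 : ℝ)..(Real.pi / 2),
        ((2 * (Real.cos x ^ (2 * α) * Real.cos (2 * n.natAbs * x)) : ℝ) : ℂ) := by
    refine intervalIntegral.integral_congr fun x hx => ?_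
    rw [Set.uIcc_of_le (by positivity)] at hx
    have h0 : 0 ≤ Real.cos x :=
      Real.cos_nonneg_of_neg_pi_div_two_le_of_le (by linarith [hx.1, Real.pi_pos]) hx.2
    have hn : Real.cos (2 * n.natAbs * x) = Real.cos (2 * n * x) := by
      rw [Nat.cast_natAbs, Int.cast_abs]
      rcases abs_choice (n : ℝ) with hn | hn
      · rw [hn]
      · rw [hn, ← Real.cos_neg]; ring_nf
    simp only [hh, hn, fourier_pi_coe, absCosRpow_coe, Real.cos_neg, abs_of_nonneg h0, smul_eq_mul]
    rw [← add_mul]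
    push_cast
    rw [show (2 * (-(n : ℂ)) * (-(x : ℂ)) * Complex.I) = 2 * n * x * Complex.I by ring,
      show (2 * (-(n : ℂ)) * (x : ℂ) * Complex.I) = -(2 * n * x) * Complex.I by ring,
      ← Complex.two_cos]
    ring
  rw [hsplit, hval, intervalIntegral.integral_ofReal, intervalIntegral.integral_const_mul,
    integral_rpow_cos_mul_cos hα, Complex.real_smul, ← Complex.ofReal_mul]
  congr 1
  field_simp
  ring

/-- Summable Fourier coefficients give pointwise convergence. Pairing n with -n counts frequency 0
twice, whence the extra c_0/2. -/
theorem hasSum_chebCoeff_mul_cos {α : ℝ} (hα : 0 < α) (u : ℝ) :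
    HasSum (fun k : ℕ => chebCoeff α 1 k * Real.cos (2 * k * u))
      (|Real.cos u| ^ (2 * α) + chebCoeff α 1 0 / 2) := by
  have hsum : Summable (fourierCoeff (absCosRpow hα)) := by
    have h1 : Summable fun k : ℕ => ((chebCoeff α 1 k / 2 : ℝ) : ℂ) := by
      refine Complex.ofRealCLM.summable ?_
      exact (summable_abs_iff.1 (summable_abs_chebCoeff hα 1)).div_const 2
    refine Summable.of_nat_of_neg ?_ ?_
    · simpa [fourierCoeff_absCosRpow] using h1
    · simpa [fourierCoeff_absCosRpow] using h1
  have h := (has_pointwise_sum_fourier_series_of_summable hsum (u : AddCircle Real.pi)).nat_add_neg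
  rw [← Complex.hasSum_ofReal]
  convert h using 1
  · ext k
    rw [fourierCoeff_absCosRpow, fourierCoeff_absCosRpow, fourier_pi_coe, fourier_pi_coe]
    simp only [Int.natAbs_natCast, Int.natAbs_neg, smul_eq_mul]
    rw [← mul_add]
    push_cast
    rw [show (2 * (-(k : ℂ)) * (u : ℂ) * Complex.I) = -(2 * k * u) * Complex.I by ring,
      ← Complex.two_cos]
    ring
  · rw [fourierCoeff_absCosRpow, absCosRpow_coe]
    simp

/-- The truncated Chebyshev series as a polynomial. -/
def chebPoly (c : ℕ → ℝ) (lam : ℝ) (m : ℕ) : Polynomial ℝ :=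
  Polynomial.C (c 0 / 2) + ∑ k ∈ Finset.Icc 1 m, Polynomial.C (c k) *
    (Polynomial.Chebyshev.T ℝ (k : ℤ)).comp (Polynomial.C (2 / lam) * Polynomial.X - 1)

theorem eval_chebPoly_eq (c : ℕ → ℝ) (lam : ℝ) (m : ℕ) (x : ℝ) :
    (chebPoly c lam m).eval x = ∑ k ∈ Finset.range (m + 1),
      c k * (Polynomial.Chebyshev.T ℝ (k : ℤ)).eval (2 / lam * x - 1) - c 0 / 2 := by
  rw [Finset.sum_range_succ', chebPoly, Finset.range_eq_Ico, Finset.sum_Ico_add' (fun k : ℕ =>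
    c k * (Polynomial.Chebyshev.T ℝ (k : ℤ)).eval (2 / lam * x - 1)) 0 m 1, zero_add,
    Finset.Ico_add_one_right_eq_Icc]
  simp only [Polynomial.eval_add, Polynomial.eval_finsetSum, Polynomial.eval_mul,
    Polynomial.eval_C, Polynomial.eval_comp, Polynomial.eval_sub, Polynomial.eval_X,
    Polynomial.eval_one, Nat.cast_zero, Polynomial.Chebyshev.T_zero]
  ring

theorem abs_rpow_sub_eval_chebPoly_le {α lam x : ℝ} (hα : 0 < α) (hlam : 0 < lam) (hx0 : 0 ≤ x)
    (hx1 : x ≤ lam) (m : ℕ) :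
    |x ^ α - (chebPoly (chebCoeff α lam) lam m).eval x| ≤
      ∑' i, |chebCoeff α lam (i + (m + 1))| := by
  -- Chosen so that x = lam cos²u with u = arccos r, i.e. 2x/lam - 1 = cos 2u.
  set r := √(x / lam) with hr
  have hr1 : r ≤ 1 := Real.sqrt_le_one.2 ((div_le_one hlam).2 hx1)
  have hr0 : 0 ≤ r := Real.sqrt_nonneg _
  set u := Real.arccos r with hu
  have hcos : Real.cos u = r := Real.cos_arccos (by linarith) hr1
  have hxr : x = lam * r ^ 2 := by
    rw [hr, Real.sq_sqrt (by positivity)]; field_simp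
  have hT : ∀ k : ℕ, (Polynomial.Chebyshev.T ℝ (k : ℤ)).eval (2 / lam * x - 1) =
      Real.cos (2 * k * u) := by
    intro k
    have : 2 / lam * x - 1 = Real.cos (2 * u) := by
      rw [Real.cos_two_mul, hcos, hxr]; field_simp
    rw [this, Polynomial.Chebyshev.T_real_cos]
    push_cast; ring_nf
  have hpow : x ^ α = lam ^ α * |Real.cos u| ^ (2 * α) := by
    rw [hcos, abs_of_nonneg hr0, hxr, Real.mul_rpow hlam.le (by positivity),
      ← Real.rpow_natCast_mul hr0]
    norm_num
  have hS := (hasSum_chebCoeff_mul_cos hα u).mul_left (lam ^ α)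
  simp only [← mul_assoc, ← chebCoeff_eq_rpow_mul] at hS
  rw [mul_add, ← hpow, mul_div_assoc', ← chebCoeff_eq_rpow_mul] at hS
  have hS' : HasSum (fun k : ℕ => chebCoeff α lam k *
      (Polynomial.Chebyshev.T ℝ (k : ℤ)).eval (2 / lam * x - 1))
      (x ^ α + chebCoeff α lam 0 / 2) := by
    simpa only [hT, mul_assoc] using hS
  rw [← hasSum_nat_add_iff' (m + 1)] at hS'
  have heq : x ^ α - (chebPoly (chebCoeff α lam) lam m).eval x =
      ∑' i, chebCoeff α lam (i + (m + 1)) *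
        (Polynomial.Chebyshev.T ℝ ((i + (m + 1) : ℕ) : ℤ)).eval (2 / lam * x - 1) := by
    rw [hS'.tsum_eq, eval_chebPoly_eq]; ring
  have hsum := (summable_nat_add_iff (m + 1)).2 (summable_abs_chebCoeff hα lam)
  rw [heq, ← Real.norm_eq_abs]
  refine tsum_of_norm_bounded hsum.hasSum fun i => ?_
  rw [Real.norm_eq_abs, abs_mul, hT]
  exact mul_le_of_le_one_right (abs_nonneg _) (Real.abs_cos_le_one _)

/-! ### Concentration of Gaussian quadratic forms -/

theorem integral_exp_mul_sq_gaussianReal {b : ℝ} (hb : 2 * b < 1) :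
    ∫ x, Real.exp (b * x ^ 2) ∂ProbabilityTheory.gaussianReal 0 1 = (√(1 - 2 * b))⁻¹ := by
  rw [ProbabilityTheory.integral_gaussianReal_eq_integral_smul one_ne_zero]
  have : ∀ x : ℝ, ProbabilityTheory.gaussianPDFReal 0 1 x • Real.exp (b * x ^ 2) =
      (√(2 * Real.pi))⁻¹ * Real.exp (-(1 / 2 - b) * x ^ 2) := by
    intro x
    rw [ProbabilityTheory.gaussianPDFReal_def, smul_eq_mul]
    simp only [NNReal.coe_one, mul_one, sub_zero]
    rw [mul_assoc, ← Real.exp_add]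
    congr 2
    ring
  simp_rw [this]
  rw [MeasureTheory.integral_const_mul, integral_gaussian, ← Real.sqrt_inv, ← Real.sqrt_inv,
    ← Real.sqrt_mul (by positivity)]
  congr 1
  have : 1 - 2 * b ≠ 0 := by linarith
  have : 1 / 2 - b ≠ 0 := by intro h; apply this; linarith
  field_simp

/-- Second-order expansion of -log(1-2b)/2 = b + b² + ...; the bound 1/6 keeps the remainder below
b². -/
theorem inv_sqrt_one_sub_le_exp {b : ℝ} (hb : |b| ≤ 1 / 6) :
    (√(1 - 2 * b))⁻¹ ≤ Real.exp (b + 2 * b ^ 2) := by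
  have hb' := abs_le.1 hb
  have hpos : 0 < 1 - 2 * b := by linarith
  have hx : |2 * b| ≤ 1 / 3 := by rw [abs_mul, abs_two]; linarith
  have h := (abs_le.1 (Real.abs_log_sub_add_sum_range_le (x := 2 * b) (by linarith) 2)).1
  simp only [Finset.sum_range_succ, Finset.sum_range_zero] at h
  have h3 : |2 * b| ^ 3 / (1 - |2 * b|) ≤ 2 * b ^ 2 := by
    rw [div_le_iff₀ (by linarith)]
    have : |2 * b| ^ 3 = 4 * b ^ 2 * |2 * b| := by
      rw [pow_succ, sq_abs]; ring
    rw [this]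
    nlinarith [sq_nonneg b]
  norm_num at h
  rw [← Real.log_le_iff_le_exp (by positivity), Real.log_inv, Real.log_sqrt hpos.le]
  norm_num at h3
  nlinarith

section Concentration

open ProbabilityTheory MeasureTheory

/-- The coordinates of a standard Gaussian in any orthonormal basis are independent standard
normals, so the moment generating function factors. -/
theorem mgf_sum_mul_sq_repr {ι E Ω : Type*} [Fintype ι] [NormedAddCommGroup E]
    [InnerProductSpace ℝ E] [FiniteDimensional ℝ E] [MeasurableSpace E] [BorelSpace E]
    [MeasurableSpace Ω] {P : Measure Ω} {g : Ω → E} (hg : HasLaw g (stdGaussian E) P)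
    (b : OrthonormalBasis ι ℝ E) (μ : ι → ℝ) (t : ℝ) (ht : ∀ i, 2 * (t * μ i) < 1) :
    mgf (fun ω => ∑ i, μ i * b.repr (g ω) i ^ 2) P t = ∏ i, (√(1 - 2 * (t * μ i)))⁻¹ := by
  have hF : Continuous fun v : E => ∑ i, μ i * b.repr v i ^ 2 := by
    refine continuous_finsetSum _ fun i _ => continuous_const.mul (Continuous.pow ?_ 2)
    exact (EuclideanSpace.proj (𝕜 := ℝ) i).continuous.comp b.repr.continuous
  have hE : Continuous fun v : E => Real.exp (t * ∑ i, μ i * b.repr v i ^ 2) :=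
    Real.continuous_exp.comp (continuous_const.mul hF)
  have h1 := mgf_map (μ := P) (Y := g) (X := fun v => ∑ i, μ i * b.repr v i ^ 2)
    hg.aemeasurable (t := t) hE.aestronglyMeasurable
  rw [hg.map_eq] at h1
  refine h1.symm.trans ?_
  rw [stdGaussian_eq_map_pi_orthonormalBasis b,
    mgf_map (Measurable.aemeasurable (by fun_prop)) hE.aestronglyMeasurable, mgf]
  have h2 : ∀ z : ι → ℝ, Real.exp (t * ((fun v => ∑ i, μ i * b.repr v i ^ 2) ∘
      fun x : ι → ℝ => ∑ i, x i • b i) z) = ∏ i, Real.exp (t * μ i * z i ^ 2) := by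
    intro z
    rw [← Real.exp_sum, Function.comp_apply, Finset.mul_sum]
    congr 1
    refine Finset.sum_congr rfl fun i _ => ?_
    rw [OrthonormalBasis.repr_apply_apply, b.orthonormal.inner_right_fintype, mul_assoc]
  simp_rw [h2]
  rw [integral_fintype_prod_eq_prod (fun i x => Real.exp (t * μ i * x ^ 2))]
  exact Finset.prod_congr rfl fun i _ => integral_exp_mul_sq_gaussianReal (ht i)

/-- A Chernoff bound for sums of independent variables with sub-gamma moment generating
functions. -/
theorem measure_abs_sum_sub_ge_le {Ω : Type*} [MeasurableSpace Ω] {P : Measure Ω}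
    [IsProbabilityMeasure P] {s : ℕ} {Y : Fin s → Ω → ℝ} (hY : ∀ i, AEMeasurable (Y i) P)
    (hindep : iIndepFun Y P) {τ M ε : ℝ} (hM : 0 < M) (hε0 : 0 < ε) (hε1 : 3 * ε ≤ 2)
    (hmgf : ∀ i t, |t| * M ≤ 1 / 6 →
      0 < mgf (Y i) P t ∧ mgf (Y i) P t ≤ Real.exp (t * τ + 2 * (t * M) ^ 2)) :
    P.real {ω | s * (ε * M) ≤ |∑ i, Y i ω - s * τ|} ≤ 2 * Real.exp (-(s * ε ^ 2 / 8)) := by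
  have hsum : ∀ t, |t| * M ≤ 1 / 6 → Integrable (fun ω => Real.exp (t * (∑ i, Y i) ω)) P ∧
      mgf (∑ i, Y i) P t ≤ Real.exp (s * (t * τ + 2 * (t * M) ^ 2)) := by
    intro t ht
    have h := hindep.mgf_sum₀ (t := t) hY Finset.univ
    constructor
    · rw [← mgf_pos_iff, h]
      exact Finset.prod_pos fun i _ => (hmgf i t ht).1
    · rw [h, Real.exp_nat_mul]
      refine (Finset.prod_le_prod (fun i _ => (hmgf i t ht).1.le)
        fun i _ => (hmgf i t ht).2).trans_eq ?_
      simp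
  -- Minimizes -tεM + 2(tM)², with value -ε²/8; the condition 3ε ≤ 2 says exactly that tM = ε/4 ≤
  -- 1/6.
  set t := ε / (4 * M) with ht
  have htM : t * M = ε / 4 := by rw [ht]; field_simp
  have htpos : 0 < t := by positivity
  have h1 : |t| * M ≤ 1 / 6 := by rw [abs_of_pos htpos, htM]; linarith
  have h2 : |-t| * M ≤ 1 / 6 := by rwa [abs_neg]
  obtain ⟨hi1, hm1⟩ := hsum t h1
  obtain ⟨hi2, hm2⟩ := hsum (-t) h2
  have hU : P.real {ω | s * τ + s * (ε * M) ≤ (∑ i, Y i) ω} ≤ Real.exp (-(s * ε ^ 2 / 8)) := by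
    refine (measure_ge_le_exp_mul_mgf _ htpos.le hi1).trans ?_
    refine (mul_le_mul_of_nonneg_left hm1 (Real.exp_pos _).le).trans_eq ?_
    rw [← Real.exp_add]
    congr 1
    linear_combination (-s * ε + 2 * s * (t * M) + 2 * s * (ε / 4)) * htM
  have hL : P.real {ω | (∑ i, Y i) ω ≤ s * τ - s * (ε * M)} ≤ Real.exp (-(s * ε ^ 2 / 8)) := by
    refine (measure_le_le_exp_mul_mgf _ (neg_nonpos.2 htpos.le) hi2).trans ?_
    refine (mul_le_mul_of_nonneg_left hm2 (Real.exp_pos _).le).trans_eq ?_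
    rw [← Real.exp_add]
    congr 1
    linear_combination (-s * ε + 2 * s * (t * M) + 2 * s * (ε / 4)) * htM
  have hsub : {ω | s * (ε * M) ≤ |∑ i, Y i ω - s * τ|} ⊆
      {ω | s * τ + s * (ε * M) ≤ (∑ i, Y i) ω} ∪ {ω | (∑ i, Y i) ω ≤ s * τ - s * (ε * M)} := by
    intro ω hω
    simp only [Set.mem_ofPred_eq, Set.mem_union, Finset.sum_apply] at hω ⊢
    rcases le_abs'.1 hω with h | h
    · right; linarith
    · left; linarith
  calc _ ≤ _ := measureReal_mono hsub
    _ ≤ _ := measureReal_union_le _ _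
    _ ≤ _ := by linarith

/-- Concentration of the Gaussian trace estimator for a symmetric matrix with eigenvalues `μ`, in
terms of a bound `M` for the trace norm. -/
theorem measure_abs_gaussianTrace_sub_ge_le {ι E Ω : Type*} [Fintype ι] [NormedAddCommGroup E]
    [InnerProductSpace ℝ E] [FiniteDimensional ℝ E] [MeasurableSpace E] [BorelSpace E]
    [MeasurableSpace Ω] {P : Measure Ω} [IsProbabilityMeasure P] {s : ℕ} {g : Fin s → Ω → E}
    (hg : ∀ i, HasLaw (g i) (stdGaussian E) P) (hindep : iIndepFun g P)
    (b : OrthonormalBasis ι ℝ E) (μ : ι → ℝ) {M ε : ℝ} (hM : 0 < M) (hμ : ∑ i, |μ i| ≤ M)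
    (hε0 : 0 < ε) (hε1 : 3 * ε ≤ 2) :
    P.real {ω | s * (ε * M) ≤ |∑ j, ∑ i, μ i * b.repr (g j ω) i ^ 2 - s * ∑ i, μ i|} ≤
      2 * Real.exp (-(s * ε ^ 2 / 8)) := by
  have hF : Continuous fun v : E => ∑ i, μ i * b.repr v i ^ 2 := by
    refine continuous_finsetSum _ fun i _ => continuous_const.mul (Continuous.pow ?_ 2)
    exact (EuclideanSpace.proj (𝕜 := ℝ) i).continuous.comp b.repr.continuous
  refine measure_abs_sum_sub_ge_le (Y := fun j ω => ∑ i, μ i * b.repr (g j ω) i ^ 2)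
    (fun j => hF.measurable.comp_aemeasurable (hg j).aemeasurable)
    (hindep.comp (fun _ v => ∑ i, μ i * b.repr v i ^ 2) fun _ => hF.measurable)
    hM hε0 hε1 fun j t ht => ?_
  have hle : ∀ i, |μ i| ≤ M := fun i =>
    (Finset.single_le_sum (f := fun i => |μ i|) (fun _ _ => abs_nonneg _)
      (Finset.mem_univ i)).trans hμ
  have hti : ∀ i, |t * μ i| ≤ 1 / 6 := fun i => by
    rw [abs_mul]
    exact (mul_le_mul_of_nonneg_left (hle i) (abs_nonneg t)).trans ht
  have hlt : ∀ i, 2 * (t * μ i) < 1 := fun i => by linarith [(abs_le.1 (hti i)).2]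
  rw [mgf_sum_mul_sq_repr (hg j) b μ t hlt]
  refine ⟨Finset.prod_pos fun i _ => ?_, ?_⟩
  · have := hlt i
    exact inv_pos.2 (Real.sqrt_pos.2 (by linarith))
  · refine (Finset.prod_le_prod (fun i _ => by positivity)
      fun i _ => inv_sqrt_one_sub_le_exp (hti i)).trans ?_
    rw [← Real.exp_sum, Real.exp_le_exp, Finset.sum_add_distrib, ← Finset.mul_sum, ← Finset.mul_sum]
    -- The trace norm dominates the Frobenius norm.
    have h2 : ∑ i, (t * μ i) ^ 2 ≤ (t * M) ^ 2 := by
      simp_rw [mul_pow, ← Finset.mul_sum]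
      refine mul_le_mul_of_nonneg_left ?_ (sq_nonneg t)
      calc ∑ i, μ i ^ 2 = ∑ i, |μ i| * |μ i| := by simp [← sq]
        _ ≤ ∑ i, |μ i| * M := Finset.sum_le_sum fun i _ =>
            mul_le_mul_of_nonneg_left (hle i) (abs_nonneg _)
        _ = (∑ i, |μ i|) * M := by rw [Finset.sum_mul]
        _ ≤ M * M := mul_le_mul_of_nonneg_right hμ hM.le
        _ = M ^ 2 := by ring
    linarith

end Concentration

/-! ### Spectral form of the estimator; the normalized kernel matrix -/

theorem chebSum_eq_aeval {n : ℕ} (c : ℕ → ℝ) (lam : ℝ) (G : Matrix (Fin n) (Fin n) ℝ) (m : ℕ) :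
    chebSum c lam G m = Polynomial.aeval G (chebPoly c lam m) := by
  simp only [chebSum, chebPoly, map_add, map_sum, map_mul, Polynomial.aeval_C,
    Polynomial.aeval_comp, map_sub, Polynomial.aeval_X, map_one, Algebra.algebraMap_eq_smul_one,
    smul_mul_assoc, one_mul]

theorem aeval_mulVec_of_mulVec_eq_smul {n : ℕ} {G : Matrix (Fin n) (Fin n) ℝ} {v : Fin n → ℝ}
    {r : ℝ} (h : G *ᵥ v = r • v) (p : Polynomial ℝ) :
    Polynomial.aeval G p *ᵥ v = p.eval r • v := by
  induction p using Polynomial.induction_on' with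
  | add p q hp hq => simp [Matrix.add_mulVec, hp, hq, add_smul]
  | monomial k a =>
    have hk : (G ^ k) *ᵥ v = r ^ k • v := by
      induction k with
      | zero => simp
      | succ k ih =>
        rw [pow_succ, ← Matrix.mulVec_mulVec, h, Matrix.mulVec_smul, ih, smul_smul, pow_succ,
          mul_comm]
    simp [Polynomial.aeval_monomial, Algebra.algebraMap_eq_smul_one, Matrix.smul_mulVec, hk,
      smul_smul]

/-- Expanding v in the eigenbasis diagonalizes f_m(G); this is the form required by the
concentration bound. -/
theorem clenshawForm_eq_sum_eigenvalues {n : ℕ} {G : Matrix (Fin n) (Fin n) ℝ}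
    (hG : G.IsHermitian) (c : ℕ → ℝ) (lam : ℝ) (m : ℕ) (v : EuclideanSpace ℝ (Fin n)) :
    clenshawForm c lam G m v.ofLp = ∑ i, (chebPoly c lam m).eval (hG.eigenvalues i) *
      hG.eigenvectorBasis.repr v i ^ 2 := by
  set b := hG.eigenvectorBasis with hb
  set p := chebPoly c lam m with hp
  have hv : v = ∑ i, b.repr v i • b i := (b.sum_repr v).symm
  have hA : Polynomial.aeval G p *ᵥ v.ofLp =
      (∑ i, (p.eval (hG.eigenvalues i) * b.repr v i) • b i : EuclideanSpace ℝ (Fin n)).ofLp := by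
    nth_rw 1 [hv]
    rw [WithLp.ofLp_sum, WithLp.ofLp_sum, Matrix.mulVec_sum]
    refine Finset.sum_congr rfl fun i _ => ?_
    rw [WithLp.ofLp_smul, WithLp.ofLp_smul, Matrix.mulVec_smul,
      aeval_mulVec_of_mulVec_eq_smul (hG.mulVec_eigenvectorBasis i), smul_smul, mul_comm]
  rw [clenshawForm_eq, chebSum_eq_aeval, hA, dotProduct_comm]
  have h := EuclideanSpace.inner_eq_star_dotProduct (𝕜 := ℝ) v
    (∑ i, (p.eval (hG.eigenvalues i) * b.repr v i) • b i)
  rw [star_trivial] at h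
  rw [← h]
  nth_rw 1 [hv]
  rw [b.orthonormal.inner_sum]
  refine Finset.sum_congr rfl fun i _ => ?_
  simp only [conj_trivial]
  ring

/-- G = DKD is a congruence of the Gram matrix K, with D diagonal. -/
theorem IsPositiveKernel.posSemidef_normalizedKernelMatrix {X : Type*} {n : ℕ} {φ : X → X → ℝ}
    (hφ : IsPositiveKernel φ) (x : Fin n → X) (hx : ∀ i, 0 < φ (x i) (x i)) :
    (normalizedKernelMatrix φ x).PosSemidef := by
  convert (hφ n x).conjTranspose_mul_mul_same
    (Matrix.diagonal fun i => 1 / (√n * √(φ (x i) (x i)))) using 1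
  ext i j
  rw [Matrix.diagonal_conjTranspose, Matrix.mul_diagonal, Matrix.diagonal_mul]
  have hn : √(n : ℝ) * √(n : ℝ) = n := Real.mul_self_sqrt n.cast_nonneg
  simp only [normalizedKernelMatrix, Matrix.of_apply, star_trivial]
  rw [Real.sqrt_mul (hx i).le]
  nth_rw 1 [← hn]
  ring

theorem trace_normalizedKernelMatrix {X : Type*} {n : ℕ} (hn : 0 < n) {φ : X → X → ℝ}
    (x : Fin n → X) (hx : ∀ i, 0 < φ (x i) (x i)) : (normalizedKernelMatrix φ x).trace = 1 := by
  have : ∀ i, normalizedKernelMatrix φ x i i = 1 / n := fun i => by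
    simp only [normalizedKernelMatrix, Matrix.of_apply]
    rw [Real.sqrt_mul_self (hx i).le, div_self (hx i).ne', mul_one]
  simp only [Matrix.trace, Matrix.diag_apply, this]
  rw [Finset.sum_const, Finset.card_univ, Fintype.card_fin, nsmul_eq_mul,
    mul_one_div_cancel (by positivity)]

/-! ### Eigenvalue bounds and the choice of degree -/

section Eigenvalues

variable {n : ℕ} {G : Matrix (Fin n) (Fin n) ℝ}

theorem eigenvalues_le_lambdaMax (hG : G.IsHermitian) (i : Fin n) :
    hG.eigenvalues i ≤ lambdaMax hG :=
  le_ciSup (Set.finite_range _).bddAbove i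

theorem lambdaMin_le_eigenvalues (hG : G.IsHermitian) (i : Fin n) :
    lambdaMin hG ≤ hG.eigenvalues i :=
  ciInf_le (Set.finite_range _).bddBelow i

theorem lambdaMax_pos (hG : G.IsHermitian) (htr : 0 < G.trace) : 0 < lambdaMax hG := by
  by_contra h
  rw [hG.trace_eq_sum_eigenvalues] at htr
  refine htr.not_ge (Finset.sum_nonpos fun i _ => ?_)
  exact (eigenvalues_le_lambdaMax hG i).trans (not_lt.1 h)

theorem lambdaMax_rpow_le_sum (hn : 0 < n) (hG : G.PosSemidef) (α : ℝ) :
    lambdaMax hG.isHermitian ^ α ≤ ∑ i, hG.isHermitian.eigenvalues i ^ α := by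
  have : Nonempty (Fin n) := ⟨⟨0, hn⟩⟩
  obtain ⟨i, hi⟩ := exists_eq_ciSup_of_finite (f := hG.isHermitian.eigenvalues)
  rw [lambdaMax, ← hi]
  exact Finset.single_le_sum (f := fun i => hG.isHermitian.eigenvalues i ^ α)
    (fun j _ => Real.rpow_nonneg (hG.eigenvalues_nonneg j) α) (Finset.mem_univ i)

theorem card_mul_lambdaMin_rpow_le_sum (hG : G.IsHermitian) (h : 0 < lambdaMin hG) {α : ℝ}
    (hα : 0 < α) : n * lambdaMin hG ^ α ≤ ∑ i, hG.eigenvalues i ^ α := by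
  have := Finset.sum_le_sum fun (i : Fin n) (_ : i ∈ Finset.univ) =>
    Real.rpow_le_rpow h.le (lambdaMin_le_eigenvalues hG i) hα.le
  simpa using this

theorem lt_chebDegree (hn : 0 < n) (hG : G.IsHermitian) (hmax : 0 < lambdaMax hG) {α ε : ℝ}
    (hα : 0 < α) (hε : 0 < ε) : α < chebDegree hG α ε := by
  have h2 : 0 < Real.Gamma (α + 1 / 2) := Real.Gamma_pos_of_pos (by positivity)
  have h1 : 0 < Real.Gamma α := Real.Gamma_pos_of_pos (by positivity)
  refine lt_of_lt_of_le ?_ (Nat.le_ceil _)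
  refine lt_add_of_pos_right _ ?_
  split_ifs with h
  · have : 0 < condNumber hG := div_pos hmax h
    positivity
  · positivity

/-- The degree is large enough for the total error of the truncated series to be at most `ε`
times the trace. -/
theorem card_mul_tsum_abs_chebCoeff_le (hn : 0 < n) (hG : G.PosSemidef) (htr : 0 < G.trace)
    {α ε : ℝ} (hα : 0 < α) (hε : 0 < ε) :
    n * ∑' i, |chebCoeff α (lambdaMax hG.isHermitian)
        (i + (chebDegree hG.isHermitian α ε + 1))| ≤
      ε * ∑ i, hG.isHermitian.eigenvalues i ^ α := by
  set hH := hG.isHermitian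
  set m := chebDegree hH α ε with hm
  have hmax := lambdaMax_pos hH htr
  have hlt := lt_chebDegree hn hH hmax hα hε
  have h2 : 0 < Real.Gamma (α + 1 / 2) := Real.Gamma_pos_of_pos (by positivity)
  have h1 : 0 < Real.Gamma α := Real.Gamma_pos_of_pos (by positivity)
  have hn' : (0 : ℝ) < n := by exact_mod_cast hn
  have htail := tsum_abs_chebCoeff_le hα hmax hlt
  rw [← hm] at htail hlt
  have hy : 0 < m - α := by linarith
  have hceil := Nat.le_ceil (α + if 0 < lambdaMin hH then
      √(condNumber hH) * (Real.Gamma (α + 1 / 2) * Real.Gamma α /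
        (ε * Real.pi ^ (3 / 2 : ℝ))) ^ (1 / (2 * α))
    else
      ((n : ℝ) * Real.Gamma (α + 1 / 2) * Real.Gamma α /
        (ε * Real.pi ^ (3 / 2 : ℝ))) ^ (1 / (2 * α)))
  change _ ≤ ((chebDegree hH α ε : ℕ) : ℝ) at hceil
  rw [← hm, ← le_sub_iff_add_le'] at hceil
  have hroot : ∀ r : ℝ, 0 < r → (r ^ (1 / (2 * α))) ^ (2 * α) = r := fun r hr => by
    rw [← Real.rpow_mul hr.le, one_div_mul_cancel (by positivity), Real.rpow_one]
  refine (mul_le_mul_of_nonneg_left htail hn'.le).trans ?_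
  rw [mul_div_assoc', div_le_iff₀ (by positivity)]
  split_ifs at hceil with h
  -- Here (√κ)^(2α) = λ_max^α / λ_min^α cancels λ_max^α in the tail and leaves n λ_min^α ≤ T.
  · have hκ : 0 < condNumber hH := div_pos hmax h
    have hpow := Real.rpow_le_rpow (by positivity) hceil (show 0 ≤ 2 * α by positivity)
    rw [Real.mul_rpow (by positivity) (by positivity), hroot _ (by positivity), Real.sqrt_eq_rpow,
      ← Real.rpow_mul hκ.le, show 1 / 2 * (2 * α) = α by ring, condNumber,
      Real.div_rpow hmax.le h.le] at hpow
    have hT := card_mul_lambdaMin_rpow_le_sum hH h hα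
    have hmin : 0 < lambdaMin hH ^ α := by positivity
    have h0 := (show 0 ≤ n * lambdaMin hH ^ α by positivity).trans hT
    calc _ = ε * (n * lambdaMin hH ^ α) * (lambdaMax hH ^ α / lambdaMin hH ^ α *
          (Real.Gamma (α + 1 / 2) * Real.Gamma α / (ε * Real.pi ^ (3 / 2 : ℝ)))) := by field_simp
      _ ≤ _ := by gcongr
  -- Without a positive λ_min, the n under the root absorbs the number of eigenvalues, and λ_max^α ≤
  -- T.
  · have hpow := Real.rpow_le_rpow (by positivity) hceil (show 0 ≤ 2 * α by positivity)
    rw [hroot _ (by positivity)] at hpow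
    have hT := lambdaMax_rpow_le_sum hn hG α
    have h0 := (Real.rpow_pos_of_pos hmax α).le.trans hT
    calc _ = ε * lambdaMax hH ^ α * (n * Real.Gamma (α + 1 / 2) * Real.Gamma α /
          (ε * Real.pi ^ (3 / 2 : ℝ))) := by field_simp
      _ ≤ _ := by gcongr

end Eigenvalues

/-! ### Logarithms and the number of query vectors -/

theorem abs_logb_sub_logb_le {T A ε : ℝ} (hT : 0 < T) (hε0 : 0 < ε) (hε1 : 3 * ε < 1)
    (h : |A - T| ≤ 3 * ε * T) :
    0 < A ∧ |Real.logb 2 T - Real.logb 2 A| ≤ |Real.logb 2 (1 - 3 * ε)| := by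
  obtain ⟨hl, hu⟩ := abs_le.1 h
  have h1 : 0 < 1 - 3 * ε := by linarith
  have hl' : (1 - 3 * ε) * T ≤ A := by linarith
  have hA : 0 < A := lt_of_lt_of_le (by positivity) hl'
  -- Since (1-3ε)(1+3ε) ≤ 1, the lower deviation governs both sides.
  have hu' : (1 - 3 * ε) * A ≤ T := by nlinarith [mul_pos hε0 hT, mul_pos (mul_pos hε0 hε0) hT]
  refine ⟨hA, ?_⟩
  have hneg : Real.logb 2 (1 - 3 * ε) ≤ 0 :=
    Real.logb_nonpos one_lt_two h1.le (by linarith)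
  have e1 := Real.logb_le_logb_of_le one_lt_two (by positivity) hl'
  have e2 := Real.logb_le_logb_of_le one_lt_two (by positivity) hu'
  rw [Real.logb_mul h1.ne' hT.ne'] at e1
  rw [Real.logb_mul h1.ne' hA.ne'] at e2
  rw [abs_of_nonpos hneg, abs_le]
  constructor <;> linarith

theorem two_mul_exp_numVectors_le {ε δ : ℝ} (hε0 : 0 < ε) (hδ0 : 0 < δ) :
    2 * Real.exp (-(numVectors ε δ * ε ^ 2 / 8)) ≤ δ := by
  have h := Nat.le_ceil (8 * Real.log (2 / δ) / ε ^ 2)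
  change _ ≤ ((numVectors ε δ : ℕ) : ℝ) at h
  rw [div_le_iff₀ (by positivity)] at h
  have h2 : Real.exp (-(numVectors ε δ * ε ^ 2 / 8)) ≤ Real.exp (-Real.log (2 / δ)) :=
    Real.exp_le_exp.2 (by linarith)
  rw [Real.exp_neg (Real.log _), Real.exp_log (by positivity), inv_div] at h2
  linarith

theorem numVectors_pos {ε δ : ℝ} (hε0 : 0 < ε) (hδ0 : 0 < δ) (hδ1 : δ < 1) :
    0 < numVectors ε δ := by
  have : 0 < Real.log (2 / δ) := Real.log_pos (by rw [lt_div_iff₀ hδ0]; linarith)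
  exact Nat.ceil_pos.2 (by positivity)

end RenyiChebyshev

end

/-! ### Combining approximation and sampling -/

open RenyiChebyshev

theorem theorem3 {X : Type*} {n : ℕ} (hn : 0 < n)
    (φ : X → X → ℝ) (hφ : RenyiChebyshev.IsPositiveKernel φ)
    (x : Fin n → X) (hx : ∀ i, 0 < φ (x i) (x i))
    (α ε δ : ℝ) (hα0 : 0 < α) (hα1 : α ≠ 1) (hε0 : 0 < ε) (hε1 : 3 * ε < 1)
    (hδ0 : 0 < δ) (hδ1 : δ < 1)
    (s m : ℕ) (hs : s = RenyiChebyshev.numVectors ε δ)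
    (hm : m = RenyiChebyshev.chebDegree (hφ.isHermitian x) α ε)
    {Ω : Type*} [MeasurableSpace Ω] (P : MeasureTheory.Measure Ω)
    [MeasureTheory.IsProbabilityMeasure P]
    (g : Fin s → Ω → EuclideanSpace ℝ (Fin n))
    (hlaw : ∀ i, ProbabilityTheory.HasLaw (g i)
      (ProbabilityTheory.stdGaussian (EuclideanSpace ℝ (Fin n))) P)
    (hindep : ProbabilityTheory.iIndepFun g P) :
    1 - δ ≤ P.real {ω |
      0 < RenyiChebyshev.traceEstimate (hφ.isHermitian x) α s m (fun i => g i ω) ∧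
      |RenyiChebyshev.entropy (hφ.isHermitian x) α -
          RenyiChebyshev.entropyEstimate (hφ.isHermitian x) α s m (fun i => g i ω)| ≤
        |1 / (1 - α) * Real.logb 2 (1 - 3 * ε)|} := by
  have hpsd := hφ.posSemidef_normalizedKernelMatrix x hx
  have htr : 0 < (normalizedKernelMatrix φ x).trace := by
    rw [trace_normalizedKernelMatrix hn x hx]; exact one_pos
  set hH := hφ.isHermitian x with hHdef
  set lam := lambdaMax hH with hlam
  have hmax : 0 < lam := lambdaMax_pos hH htr
  set T := ∑ i, hH.eigenvalues i ^ α with hT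
  have hTpos : 0 < T :=
    (Real.rpow_pos_of_pos hmax α).trans_le (lambdaMax_rpow_le_sum hn hpsd α)
  set μ : Fin n → ℝ := fun i => (chebPoly (chebCoeff α lam) lam m).eval (hH.eigenvalues i) with hμ
  have herr : ∑ i, |hH.eigenvalues i ^ α - μ i| ≤ ε * T := by
    refine le_trans ?_ (card_mul_tsum_abs_chebCoeff_le hn hpsd htr hα0 hε0)
    rw [← hm]
    refine (Finset.sum_le_sum fun i _ => abs_rpow_sub_eval_chebPoly_le hα0 hmax
      (hpsd.eigenvalues_nonneg i) (eigenvalues_le_lambdaMax hH i) m).trans_eq ?_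
    rw [Finset.sum_const, Finset.card_univ, Fintype.card_fin, nsmul_eq_mul]
  have hsumμ : |∑ i, μ i - T| ≤ ε * T := by
    rw [hT, ← Finset.sum_sub_distrib]
    refine (Finset.abs_sum_le_sum_abs _ _).trans ?_
    simpa only [abs_sub_comm] using herr
  have habsμ : ∑ i, |μ i| ≤ (1 + ε) * T := by
    have : ∀ i, |μ i| ≤ hH.eigenvalues i ^ α + |hH.eigenvalues i ^ α - μ i| := fun i => by
      have h0 := Real.rpow_nonneg (hpsd.eigenvalues_nonneg i) α
      have := abs_sub_abs_le_abs_sub (μ i) (hH.eigenvalues i ^ α)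
      rw [abs_of_nonneg h0, abs_sub_comm] at this
      linarith
    refine (Finset.sum_le_sum fun i _ => this i).trans ?_
    rw [Finset.sum_add_distrib]
    linarith
  have hspos : (0 : ℝ) < s := by rw [hs]; exact_mod_cast numVectors_pos hε0 hδ0 hδ1
  set B : Set Ω := {ω | s * (ε * ((1 + ε) * T)) ≤
    |∑ j, ∑ i, μ i * hH.eigenvectorBasis.repr (g j ω) i ^ 2 - s * ∑ i, μ i|} with hB
  have hPB : P.real B ≤ δ := by
    refine (measure_abs_gaussianTrace_sub_ge_le hlaw hindep hH.eigenvectorBasis μ (by positivity)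
      habsμ hε0 (by linarith)).trans ?_
    rw [hs]
    exact two_mul_exp_numVectors_le hε0 hδ0
  have hgood : ∀ ω, ω ∉ B → 0 < traceEstimate hH α s m (fun i => g i ω) ∧
      |entropy hH α - entropyEstimate hH α s m (fun i => g i ω)| ≤
        |1 / (1 - α) * Real.logb 2 (1 - 3 * ε)| := by
    intro ω hω
    have hest : traceEstimate hH α s m (fun i => g i ω) =
        1 / s * ∑ j, ∑ i, μ i * hH.eigenvectorBasis.repr (g j ω) i ^ 2 := by
      simp only [traceEstimate, clenshawForm_eq_sum_eigenvalues hH, hμ, hlam]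
    have hdev : |traceEstimate hH α s m (fun i => g i ω) - ∑ i, μ i| ≤ ε * ((1 + ε) * T) := by
      rw [hB, Set.mem_ofPred_eq, not_le] at hω
      rw [hest, show ∀ a b : ℝ, 1 / s * a - b = (a - s * b) / s by intro a b; field_simp,
        abs_div, abs_of_pos hspos, div_le_iff₀ hspos]
      linarith
    have htot : |traceEstimate hH α s m (fun i => g i ω) - T| ≤ 3 * ε * T := by
      refine (abs_sub_le _ (∑ i, μ i) _).trans ((add_le_add hdev hsumμ).trans ?_)
      -- ε(1+ε) + ε ≤ 3ε because ε < 1.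
      nlinarith [mul_pos hε0 hTpos]
    obtain ⟨hpos, hlog⟩ := abs_logb_sub_logb_le hTpos hε0 hε1 htot
    refine ⟨hpos, ?_⟩
    rw [entropy, entropyEstimate, ← mul_sub, abs_mul, abs_mul]
    exact mul_le_mul_of_nonneg_left hlog (abs_nonneg _)
  -- Subadditivity suffices here, so no measurability of B is needed.
  have hcover : (1 : ℝ) ≤ P.real B + P.real Bᶜ := by
    have h := MeasureTheory.measureReal_union_le (μ := P) B Bᶜ
    rwa [Set.union_compl_self, MeasureTheory.probReal_univ] at h
  have hmono : P.real Bᶜ ≤ _ := MeasureTheory.measureReal_mono (μ := P) (fun ω hω => hgood ω hω)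
  exact le_trans (by linarith) hmono
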